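/- Let $G$ be a discrete group with identity $e$ and let $\sigma : G\times G\to\mathbb{T}$ be a multiplier on $G$, that is, $\sigma(a,b)\sigma(ab,c)=\sigma(a,bc)\sigma(b,c)$ and $\sigma(a,e)=\sigma(e,a)=1$ for all $a,b,c\in G$. Let $\ell^1(G,\sigma)$ be the Banach $*$-algebra $\ell^1(G)$ with the norm $\|\cdot\|_1$, the twisted convolution $(f*_\sigma g)(a)=\sum_{b\in G}f(b)\sigma(b,b^{-1}a)g(b^{-1}a)$ and the involution $f^*(a)=\overline{\sigma(a,a^{-1})}\,\overline{f(a^{-1})}$, and let the full twisted group $C^*$-algebra $C^*(G,\sigma)$ be its universal enveloping $C^*$-algebra. A $C^*$-algebra is prime if any two nonzero (closed two-sided) ideals have nonzero intersection. An element $a\in G$ is $\sigma$-regular if $\sigma(a,b)=\sigma(b,a)$ for every $b\in G$ commuting with $a$, a conjugacy class is $\sigma$-regular if its elements are, and $(G,\sigma)$ satisfies condition K if every $\sigma$-regular conjugacy class of $G$ other than $\{e\}$ is infinite. If $C^*(G,\sigma)$ is prime, then $(G,\sigma)$ satisfies condition K. -/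

import Mathlib

open scoped ComplexConjugate

/-- A multiplier on `G`: a circle-valued `2`-cocycle `σ` with `σ(a, e) = σ(e, a) = 1`. -/
structure Multiplier (G : Type*) [Group G] where
  /-- the underlying function -/
  toFun : G → G → Circle
  cocycle' : ∀ a b c : G, toFun a b * toFun (a * b) c = toFun a (b * c) * toFun b c
  map_one_right' : ∀ a : G, toFun a 1 = 1
  map_one_left' : ∀ a : G, toFun 1 a = 1

namespace Multiplier

variable {G : Type*} [Group G]

instance : CoeFun (Multiplier G) fun _ => G → G → Circle := ⟨Multiplier.toFun⟩

variable (σ : Multiplier G)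

theorem cocycle (a b c : G) : σ a b * σ (a * b) c = σ a (b * c) * σ b c := σ.cocycle' a b c
@[simp] theorem map_one_right (a : G) : σ a 1 = 1 := σ.map_one_right' a
@[simp] theorem map_one_left (a : G) : σ 1 a = 1 := σ.map_one_left' a

/-- `a` is `σ`-regular if `σ(a, b) = σ(b, a)` for every `b` commuting with `a`. -/
def IsRegular (a : G) : Prop := ∀ b : G, Commute b a → σ a b = σ b a

variable {σ} in
/-- Every conjugate of a `σ`-regular element is `σ`-regular. -/
theorem IsRegular.conj {a : G} (ha : σ.IsRegular a) (c : G) : σ.IsRegular (c * a * c⁻¹) := by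
  intro b hb
  set d := c⁻¹ * b * c with hd
  set x := c * a * c⁻¹ with hx
  have hda : Commute d a := by
    have h : b * x = x * b := hb
    have : a = c⁻¹ * x * c := by simp [hx, mul_assoc]
    change d * a = a * d
    rw [this, hd]
    have h2 : c⁻¹ * b * c * (c⁻¹ * x * c) = c⁻¹ * (b * x) * c := by group
    have h3 : c⁻¹ * x * c * (c⁻¹ * b * c) = c⁻¹ * (x * b) * c := by group
    rw [h2, h3, h]
  have h0 := ha d hda
  have hcd : c * d = b * c := by simp [hd, mul_assoc]
  have hca : c * a = x * c := by simp [hx, mul_assoc]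
  have had : a * d = d * a := hda.symm.eq
  have hxb : x * b = b * x := hb.symm.eq
  -- both sides are computed from `σ` on `(c, a * d)`
  have e1 := σ.cocycle c a d
  have e2 := σ.cocycle x c d
  have e3 := σ.cocycle x b c
  have f1 := σ.cocycle c d a
  have f2 := σ.cocycle b c a
  have f3 := σ.cocycle b x c
  rw [hca, had, h0] at e1
  rw [hcd] at e2 f1
  rw [hca] at f2
  rw [hxb] at e3
  refine mul_right_cancel (b := σ (b * x) c * (σ c d * σ (b * c) a)) ?_
  calc σ x b * (σ (b * x) c * (σ c d * σ (b * c) a))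
      = (σ x b * σ (b * x) c) * (σ c d * σ (b * c) a) := by ac_rfl
    _ = (σ x (b * c) * σ c d) * (σ b c * σ (b * c) a) := by rw [e3]; ac_rfl
    _ = (σ b (x * c) * σ x c) * (σ c a * σ (x * c) d) := by rw [← e2, f2]; ac_rfl
    _ = σ b x * (σ (b * x) c * (σ c d * σ (b * c) a)) := by rw [← f3, e1, ← f1]; ac_rfl

/-- A conjugacy class is `σ`-regular if its elements are `σ`-regular. -/
def IsRegularClass (C : ConjClasses G) : Prop := ∀ a ∈ C.carrier, σ.IsRegular a

/-- `(G, σ)` satisfies condition K if every nontrivial `σ`-regular conjugacy class of `G`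
is infinite. -/
def ConditionK : Prop :=
  ∀ C : ConjClasses G, C ≠ 1 → σ.IsRegularClass C → C.carrier.Infinite

end Multiplier

/-! ### The Banach `*`-algebra `ℓ¹(G, σ)` -/

/-- The Banach space `ℓ¹(G)`, as the carrier of the twisted convolution algebra `ℓ¹(G, σ)`. -/
def TwistedL1 {G : Type*} [Group G] (_σ : Multiplier G) : Type _ := lp (fun _ : G => ℂ) 1

namespace TwistedL1

variable {G : Type*} [Group G] {σ : Multiplier G}

noncomputable instance : NormedAddCommGroup (TwistedL1 σ) :=
  inferInstanceAs (NormedAddCommGroup (lp (fun _ : G => ℂ) 1))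
noncomputable instance : NormedSpace ℂ (TwistedL1 σ) :=
  inferInstanceAs (NormedSpace ℂ (lp (fun _ : G => ℂ) 1))
instance : CompleteSpace (TwistedL1 σ) :=
  inferInstanceAs (CompleteSpace (lp (fun _ : G => ℂ) 1))
instance : FunLike (TwistedL1 σ) G ℂ where
  coe f := f.1
  coe_injective _ _ h := Subtype.ext h

@[ext] theorem ext {f g : TwistedL1 σ} (h : ∀ a, f a = g a) : f = g := DFunLike.ext f g h

@[simp] theorem add_apply (f g : TwistedL1 σ) (a : G) : (f + g) a = f a + g a := rfl
@[simp] theorem zero_apply (a : G) : (0 : TwistedL1 σ) a = 0 := rfl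
@[simp] theorem smul_apply (z : ℂ) (f : TwistedL1 σ) (a : G) : (z • f) a = z * f a := rfl

theorem summable_norm (f : TwistedL1 σ) : Summable fun a => ‖f a‖ := by
  have := (lp.memℓp f).summable (by simp)
  simp only [ENNReal.toReal_one, Real.rpow_one] at this
  exact this

theorem norm_eq_tsum (f : TwistedL1 σ) : ‖f‖ = ∑' a, ‖f a‖ := by
  have := lp.norm_eq_tsum_rpow (p := 1) (by simp) f
  simp only [ENNReal.toReal_one, Real.rpow_one, one_div, inv_one] at this
  exact this

theorem norm_apply_le (f : TwistedL1 σ) (a : G) : ‖f a‖ ≤ ‖f‖ := by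
  rw [norm_eq_tsum]
  exact f.summable_norm.le_tsum a fun _ _ => norm_nonneg _

/-- An absolutely summable function, as an element of `ℓ¹(G, σ)`. -/
def mk (f : G → ℂ) (hf : Summable fun a => ‖f a‖) : TwistedL1 σ :=
  ⟨f, memℓp_gen (p := 1) (by simpa using hf)⟩

@[simp] theorem mk_apply (f : G → ℂ) (hf : Summable fun a => ‖f a‖) (a : G) :
    (mk f hf : TwistedL1 σ) a = f a := rfl

/-- The bijection `(a, b) ↦ (b, b⁻¹ a)`. -/
@[simps]
def convEquiv (G : Type*) [Group G] : G × G ≃ G × G where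
  toFun p := (p.2, p.2⁻¹ * p.1)
  invFun p := (p.1 * p.2, p.1)
  left_inv p := by simp
  right_inv p := by simp

theorem summable_prod (f g : TwistedL1 σ) :
    Summable fun p : G × G => ‖f p.2‖ * ‖g (p.2⁻¹ * p.1)‖ := by
  have h := f.summable_norm.mul_of_nonneg g.summable_norm
    (fun _ => norm_nonneg _) fun _ => norm_nonneg _
  rw [← (convEquiv G).summable_iff] at h
  simpa only [Function.comp_def, convEquiv_apply] using h

theorem norm_term (f g : TwistedL1 σ) (a b : G) :
    ‖f b * σ b (b⁻¹ * a) * g (b⁻¹ * a)‖ = ‖f b‖ * ‖g (b⁻¹ * a)‖ := by simp [Circle.norm_coe]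

theorem summable_term_norm (f g : TwistedL1 σ) (a : G) :
    Summable fun b => ‖f b * σ b (b⁻¹ * a) * g (b⁻¹ * a)‖ := by
  simp only [norm_term]
  exact (summable_prod f g).prod_factor a

theorem summable_term (f g : TwistedL1 σ) (a : G) :
    Summable fun b => f b * σ b (b⁻¹ * a) * g (b⁻¹ * a) := (summable_term_norm f g a).of_norm

theorem norm_conv_le (f g : TwistedL1 σ) (a : G) :
    ‖∑' b, f b * σ b (b⁻¹ * a) * g (b⁻¹ * a)‖ ≤ ∑' b, ‖f b‖ * ‖g (b⁻¹ * a)‖ :=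
  (norm_tsum_le_tsum_norm (summable_term_norm f g a)).trans_eq (by simp only [norm_term])

/-- Twisted convolution: `(f * g)(a) = ∑ b, f(b) σ(b, b⁻¹ a) g(b⁻¹ a)`. -/
noncomputable instance : Mul (TwistedL1 σ) where
  mul f g := mk (fun a => ∑' b, f b * σ b (b⁻¹ * a) * g (b⁻¹ * a)) <|
    .of_nonneg_of_le (fun _ => norm_nonneg _) (norm_conv_le f g) (summable_prod f g).prod

theorem mul_apply (f g : TwistedL1 σ) (a : G) :
    (f * g) a = ∑' b, f b * σ b (b⁻¹ * a) * g (b⁻¹ * a) := rfl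

/-- The involution `f^*(a) = conj σ(a, a⁻¹) conj f(a⁻¹)`. -/
noncomputable instance : Star (TwistedL1 σ) where
  star f := mk (fun a => conj (σ a a⁻¹ : ℂ) * conj (f a⁻¹)) <| by
    simp only [norm_mul, RCLike.norm_conj, Circle.norm_coe, one_mul]
    have h := f.summable_norm
    rw [← (Equiv.inv G).summable_iff] at h
    simpa only [Function.comp_def, Equiv.inv_apply] using h

theorem star_apply (f : TwistedL1 σ) (a : G) :
    (star f) a = conj (σ a a⁻¹ : ℂ) * conj (f a⁻¹) := rfl

open Classical in
/-- The unit of `ℓ¹(G, σ)` is the point mass at the identity. -/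
noncomputable instance : One (TwistedL1 σ) where
  one := mk (fun a => if a = 1 then 1 else 0)
    (summable_of_ne_finset_zero (s := {1}) fun b hb => by simpa using hb)

@[simp] theorem one_apply_one : (1 : TwistedL1 σ) 1 = 1 := if_pos rfl

theorem one_apply_ne {a : G} (ha : a ≠ 1) : (1 : TwistedL1 σ) a = 0 := if_neg ha

theorem norm_mul_le (f g : TwistedL1 σ) : ‖f * g‖ ≤ ‖f‖ * ‖g‖ := by
  have h := summable_prod f g
  calc ‖f * g‖ = ∑' a, ‖(f * g) a‖ := norm_eq_tsum _
    _ ≤ ∑' a, ∑' b, ‖f b‖ * ‖g (b⁻¹ * a)‖ :=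
      (f * g).summable_norm.tsum_le_tsum (norm_conv_le f g) h.prod
    _ = ∑' p : G × G, ‖f p.2‖ * ‖g (p.2⁻¹ * p.1)‖ := h.tsum_prod.symm
    _ = ∑' p : G × G, ‖f p.1‖ * ‖g p.2‖ := by
      rw [← (convEquiv G).tsum_eq fun p : G × G => ‖f p.1‖ * ‖g p.2‖]
      simp only [convEquiv_apply]
    _ = ‖f‖ * ‖g‖ := by
      rw [norm_eq_tsum, norm_eq_tsum]
      exact (f.summable_norm.tsum_mul_tsum g.summable_norm (f.summable_norm.mul_of_nonneg
        g.summable_norm (fun _ => norm_nonneg _) fun _ => norm_nonneg _)).symm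

theorem circle_conj_mul (z : Circle) : conj (z : ℂ) * z = 1 := by
  rw [← Circle.coe_inv_eq_conj, ← Circle.coe_mul]; simp

/-- `σ` as a complex valued cocycle. -/
theorem cocycle_coe (a b c : G) :
    (σ a b : ℂ) * σ (a * b) c = σ a (b * c) * σ b c := by
  exact_mod_cast congrArg (fun z : Circle => (z : ℂ)) (σ.cocycle a b c)

theorem summable_assoc (f g h : TwistedL1 σ) (a : G) : Summable (Function.uncurry fun b c : G =>
    f c * g (c⁻¹ * b) * (σ c (c⁻¹ * b) * σ b (b⁻¹ * a) * h (b⁻¹ * a))) := by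
  refine Summable.of_norm_bounded ((summable_prod f g).mul_right ‖h‖) fun p => ?_
  simp only [Function.uncurry, norm_mul, Circle.norm_coe, one_mul]
  exact mul_le_mul_of_nonneg_left (h.norm_apply_le _) (by positivity)

theorem conv_conv_left (f g h : TwistedL1 σ) (a : G) : (f * g * h) a =
    ∑' b, ∑' c, f c * g (c⁻¹ * b) * (σ c (c⁻¹ * b) * σ b (b⁻¹ * a) * h (b⁻¹ * a)) := by
  rw [mul_apply]
  refine tsum_congr fun b => ?_
  rw [mul_apply, ← tsum_mul_right, ← tsum_mul_right]
  exact tsum_congr fun c => by ring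

theorem conv_conv_right (f g h : TwistedL1 σ) (a : G) : (f * (g * h)) a =
    ∑' c, ∑' b, f c * g (c⁻¹ * b) * (σ c (c⁻¹ * b) * σ b (b⁻¹ * a) * h (b⁻¹ * a)) := by
  rw [mul_apply]
  refine tsum_congr fun c => ?_
  rw [mul_apply, ← tsum_mul_left]
  refine (tsum_congr fun d => ?_).trans ((Equiv.mulLeft c).tsum_eq _)
  have h1 := cocycle_coe (σ := σ) c d (d⁻¹ * (c⁻¹ * a))
  rw [mul_inv_cancel_left] at h1
  rw [Equiv.coe_mulLeft, inv_mul_cancel_left, mul_inv_rev, mul_assoc d⁻¹, h1]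
  ring

theorem conv_assoc (f g h : TwistedL1 σ) : f * g * h = f * (g * h) :=
  ext fun a => by
    rw [conv_conv_left, conv_conv_right]
    exact (summable_assoc f g h a).tsum_comm.symm

noncomputable instance : Ring (TwistedL1 σ) where
  __ := (inferInstance : AddCommGroup (TwistedL1 σ))
  left_distrib f g h := by
    ext a
    simp only [mul_apply, add_apply, mul_add]
    exact (summable_term f g a).tsum_add (summable_term f h a)
  right_distrib f g h := by
    ext a
    simp only [mul_apply, add_apply, add_mul]
    exact (summable_term f h a).tsum_add (summable_term g h a)
  zero_mul f := by ext a; simp [mul_apply]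
  mul_zero f := by ext a; simp [mul_apply]
  mul_assoc := conv_assoc
  one_mul f := by
    ext a
    rw [mul_apply, tsum_eq_single 1 fun b hb => by simp [one_apply_ne hb]]
    simp
  mul_one f := by
    ext a
    rw [mul_apply, tsum_eq_single a fun b hb => by
      have : b⁻¹ * a ≠ 1 := fun h => hb (inv_mul_eq_one.1 h)
      simp [one_apply_ne this]]
    simp

noncomputable instance : NormedRing (TwistedL1 σ) where
  __ := (inferInstance : NormedAddCommGroup (TwistedL1 σ))
  __ := (inferInstance : Ring (TwistedL1 σ))
  norm_mul_le := norm_mul_le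

instance : NormOneClass (TwistedL1 σ) where
  norm_one := by
    rw [norm_eq_tsum, tsum_eq_single 1 fun b hb => by simp [one_apply_ne hb]]
    simp

noncomputable instance : NormedAlgebra ℂ (TwistedL1 σ) where
  __ := Algebra.ofModule
    (fun z f g => by
      ext a
      simp only [mul_apply, smul_apply, ← tsum_mul_left, mul_assoc])
    (fun z f g => by
      ext a
      simp only [mul_apply, smul_apply, ← tsum_mul_left]
      exact tsum_congr fun b => by ring)
  norm_smul_le := norm_smul_le

theorem star_cocycle (a b : G) :
    conj (σ a a⁻¹ : ℂ) * conj (σ (a⁻¹ * b) b⁻¹ : ℂ) =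
      conj (σ b b⁻¹ : ℂ) * σ b (b⁻¹ * a) * conj (σ (b⁻¹ * a) (b⁻¹ * a)⁻¹ : ℂ) := by
  obtain ⟨c, rfl⟩ : ∃ c, a = b * c := ⟨b⁻¹ * a, by simp⟩
  have h1 := σ.cocycle b c (c⁻¹ * b⁻¹)
  have h2 := σ.cocycle c c⁻¹ b⁻¹
  simp only [mul_inv_cancel, mul_inv_cancel_left, Multiplier.map_one_left, mul_one] at h1 h2
  have key : σ b c * σ (b * c) (c⁻¹ * b⁻¹) * σ c⁻¹ b⁻¹ = σ b b⁻¹ * σ c c⁻¹ := by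
    rw [h1, h2, mul_assoc]
  simp only [mul_inv_rev, inv_mul_cancel_left, inv_mul_cancel_right, ← Circle.coe_inv_eq_conj,
    ← Circle.coe_mul]
  refine congrArg (fun z : Circle => (z : ℂ)) ?_
  rw [← mul_inv, mul_right_comm, ← mul_inv, eq_inv_mul_iff_mul_eq, ← key, mul_assoc (σ b c),
    mul_inv_cancel_right]

noncomputable instance : StarRing (TwistedL1 σ) where
  star_involutive f := by
    ext a
    have h := cocycle_coe (σ := σ) a a⁻¹ a
    simp only [mul_inv_cancel, inv_mul_cancel, Multiplier.map_one_left, Multiplier.map_one_right,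
      Circle.coe_one, mul_one, one_mul] at h
    simp only [star_apply, map_mul, inv_inv, Complex.conj_conj, ← mul_assoc, ← h,
      circle_conj_mul, one_mul]
  star_add f g := by ext a; simp [star_apply, mul_add]
  star_mul f g := by
    ext a
    rw [star_apply, mul_apply, mul_apply, Complex.conj_tsum, ← tsum_mul_left]
    refine ((Equiv.mulLeft a⁻¹).tsum_eq _).symm.trans (tsum_congr fun b => ?_)
    have h := star_cocycle (σ := σ) a b
    have e1 : (a⁻¹ * b)⁻¹ * a⁻¹ = b⁻¹ := by group
    have e2 : (b⁻¹ * a)⁻¹ = a⁻¹ * b := by group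
    rw [e2] at h
    simp only [Equiv.coe_mulLeft, e1, e2, map_mul, star_apply]
    linear_combination conj (f (a⁻¹ * b)) * conj (g b⁻¹) * h

instance : StarModule ℂ (TwistedL1 σ) where
  star_smul z f := by ext a; simp [star_apply, mul_left_comm]

instance : NormedStarGroup (TwistedL1 σ) where
  norm_star_le f := by
    rw [norm_eq_tsum, norm_eq_tsum, ← (Equiv.inv G).tsum_eq fun a => ‖f a‖]
    simp only [star_apply, norm_mul, RCLike.norm_conj, Circle.norm_coe, one_mul, Equiv.inv_apply,
      le_refl]

end TwistedL1

/-! ### The universal enveloping `C*`-algebra of a unital Banach `*`-algebra -/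

section Enveloping

universe u

/-- The carrier of a unital Banach `*`-algebra `A`, to be normed by the largest `C*`-seminorm. -/
def PreEnveloping (A : Type u) : Type u := A

namespace PreEnveloping

variable {A : Type u} [NormedRing A] [NormedAlgebra ℂ A] [StarRing A]

noncomputable instance : Ring (PreEnveloping A) := inferInstanceAs (Ring A)
noncomputable instance : Algebra ℂ (PreEnveloping A) := inferInstanceAs (Algebra ℂ A)
instance : StarRing (PreEnveloping A) := inferInstanceAs (StarRing A)
instance [StarModule ℂ A] : StarModule ℂ (PreEnveloping A) := inferInstanceAs (StarModule ℂ A)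

/-- The set of all values `‖π(a)‖`, where `π` runs through the (unital) `*`-representations of `A`
on Hilbert spaces. Hilbert spaces in the universe of `A` suffice, as every cyclic representation
of `A` acts on a completion of a quotient of `A`. -/
def repNorms (a : A) : Set ℝ :=
  {r | ∃ (H : Type u) (_ : NormedAddCommGroup H) (_ : InnerProductSpace ℂ H) (_ : CompleteSpace H)
    (π : A →⋆ₐ[ℂ] (H →L[ℂ] H)), r = ‖π a‖}

/-- The seminorm `‖a‖ = sup_π ‖π(a)‖`. -/
noncomputable instance : Norm (PreEnveloping A) := ⟨fun a => sSup (repNorms (A := A) a)⟩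

theorem repNorms_nonempty (a : A) : (repNorms a).Nonempty :=
  ⟨_, PUnit, inferInstance, inferInstance, inferInstance,
    { toFun := fun _ => 0
      map_one' := Subsingleton.elim _ _
      map_mul' := fun _ _ => Subsingleton.elim _ _
      map_zero' := rfl
      map_add' := fun _ _ => Subsingleton.elim _ _
      commutes' := fun _ => Subsingleton.elim _ _
      map_star' := fun _ => Subsingleton.elim _ _ }, rfl⟩

theorem norm_le {a : PreEnveloping A} {c : ℝ}
    (h : ∀ (H : Type u) [NormedAddCommGroup H] [InnerProductSpace ℂ H] [CompleteSpace H]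
      (π : PreEnveloping A →⋆ₐ[ℂ] (H →L[ℂ] H)), ‖π a‖ ≤ c) : ‖a‖ ≤ c := by
  refine csSup_le (repNorms_nonempty (A := A) a) ?_
  rintro _ ⟨H, _, _, _, π, rfl⟩
  exact h H π

variable [CompleteSpace A] [NormOneClass A] [NormedStarGroup A]

/-- A `*`-homomorphism from a unital Banach `*`-algebra into a `C*`-algebra is contractive. -/
theorem starAlgHom_norm_le {B : Type*} [CStarAlgebra B] (π : A →⋆ₐ[ℂ] B) (a : A) :
    ‖π a‖ ≤ ‖a‖ := by
  have h1 : (‖star (π a) * π a‖₊ : ENNReal) ≤ ‖star a * a‖₊ := by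
    rw [← (IsSelfAdjoint.star_mul_self (π a)).spectralRadius_eq_nnnorm, ← map_star, ← map_mul]
    exact (iSup_le_iSup_of_subset (AlgHom.spectrum_apply_subset π (star a * a))).trans
      (spectrum.spectralRadius_le_nnnorm (𝕜 := ℂ) (star a * a))
  have h2 : ‖star (π a) * π a‖ ≤ ‖star a * a‖ := by exact_mod_cast h1
  rw [CStarRing.norm_star_mul_self] at h2
  have h3 : ‖star a * a‖ ≤ ‖a‖ * ‖a‖ := (norm_mul_le _ _).trans_eq (by rw [norm_star])
  exact abs_le_of_sq_le_sq' (by nlinarith) (norm_nonneg a) |>.2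

theorem repNorms_bddAbove (a : A) : BddAbove (repNorms a) := by
  refine ⟨‖a‖, ?_⟩
  rintro _ ⟨H, _, _, _, π, rfl⟩
  exact starAlgHom_norm_le π a

theorem le_norm {H : Type u} [NormedAddCommGroup H] [InnerProductSpace ℂ H] [CompleteSpace H]
    (π : PreEnveloping A →⋆ₐ[ℂ] (H →L[ℂ] H)) (a : PreEnveloping A) : ‖π a‖ ≤ ‖a‖ :=
  le_csSup (repNorms_bddAbove (A := A) a) ⟨H, _, _, _, π, rfl⟩

theorem norm_nonneg' (a : PreEnveloping A) : 0 ≤ ‖a‖ := by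
  obtain ⟨_, H, _, _, _, π, rfl⟩ := repNorms_nonempty (A := A) a
  exact (norm_nonneg _).trans (le_norm π a)

theorem norm_star_mul_self' (a : PreEnveloping A) : ‖star a * a‖ = ‖a‖ * ‖a‖ := by
  refine le_antisymm (norm_le fun H _ _ _ π => ?_) ?_
  · rw [map_mul, map_star, CStarRing.norm_star_mul_self]
    exact mul_self_le_mul_self (norm_nonneg _) (le_norm π a)
  · have h : ‖a‖ ≤ √‖star a * a‖ := norm_le fun H _ _ _ π => Real.le_sqrt_of_sq_le <| by
      rw [pow_two, ← CStarRing.norm_star_mul_self, ← map_star, ← map_mul]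
      exact le_norm π _
    rw [← pow_two]
    exact (Real.le_sqrt (norm_nonneg' a) (norm_nonneg' _)).1 h

theorem norm_star' (a : PreEnveloping A) : ‖star a‖ = ‖a‖ := by
  have h (a : PreEnveloping A) : ‖star a‖ ≤ ‖a‖ := norm_le fun H _ _ _ π => by
    rw [map_star, norm_star]
    exact le_norm π a
  exact le_antisymm (h a) (by simpa using h (star a))

noncomputable instance : SeminormedRing (PreEnveloping A) where
  __ := SeminormedAddCommGroup.ofCore (𝕜 := ℂ) (E := PreEnveloping A)
    { norm_nonneg := norm_nonneg'
      norm_smul := fun z a => by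
        have h (z : ℂ) (a : PreEnveloping A) : ‖z • a‖ ≤ ‖z‖ * ‖a‖ := norm_le fun H _ _ _ π => by
          rw [map_smul, norm_smul]
          exact mul_le_mul_of_nonneg_left (le_norm π a) (norm_nonneg z)
        rcases eq_or_ne z 0 with rfl | hz
        · refine le_antisymm (h 0 a) ?_
          simpa using norm_nonneg' _
        · refine le_antisymm (h z a) ?_
          have h2 := h z⁻¹ (z • a)
          rw [smul_smul, inv_mul_cancel₀ hz, one_smul, norm_inv] at h2
          calc ‖z‖ * ‖a‖ ≤ ‖z‖ * (‖z‖⁻¹ * ‖z • a‖) :=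
                mul_le_mul_of_nonneg_left h2 (norm_nonneg z)
            _ = ‖z • a‖ := mul_inv_cancel_left₀ (norm_ne_zero_iff.2 hz) _
      norm_triangle := fun a b => norm_le fun H _ _ _ π => by
        rw [map_add]
        exact (norm_add_le _ _).trans (add_le_add (le_norm π a) (le_norm π b)) }
  __ := (inferInstance : Ring (PreEnveloping A))
  norm_mul_le a b := norm_le fun H _ _ _ π => by
    rw [map_mul]
    exact (norm_mul_le _ _).trans
      (mul_le_mul (le_norm π a) (le_norm π b) (norm_nonneg _) (norm_nonneg' a))

noncomputable instance : NormedAlgebra ℂ (PreEnveloping A) where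
  norm_smul_le z a := norm_le fun H _ _ _ π => by
    rw [map_smul, norm_smul]
    exact mul_le_mul_of_nonneg_left (le_norm π a) (norm_nonneg z)

instance : NormedStarGroup (PreEnveloping A) where
  norm_star_le a := (norm_star' a).le

end PreEnveloping

/-- The universal enveloping `C*`-algebra of a unital Banach `*`-algebra `A`: the Hausdorff
completion of `A` with respect to the seminorm `‖a‖ = sup_π ‖π(a)‖`, where `π` runs through the
`*`-representations of `A` on Hilbert spaces. -/
def EnvelopingCStarAlgebra (A : Type u) [NormedRing A] [NormedAlgebra ℂ A] [StarRing A]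
    [StarModule ℂ A] [CompleteSpace A] [NormOneClass A] [NormedStarGroup A] : Type u :=
  UniformSpace.Completion (PreEnveloping A)

namespace EnvelopingCStarAlgebra

open UniformSpace

variable {A : Type u} [NormedRing A] [NormedAlgebra ℂ A] [StarRing A]
    [StarModule ℂ A] [CompleteSpace A] [NormOneClass A] [NormedStarGroup A]

noncomputable instance : NormedRing (EnvelopingCStarAlgebra A) :=
  inferInstanceAs (NormedRing (Completion (PreEnveloping A)))
noncomputable instance : Algebra ℂ (EnvelopingCStarAlgebra A) :=
  inferInstanceAs (Algebra ℂ (Completion (PreEnveloping A)))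
instance : CompleteSpace (EnvelopingCStarAlgebra A) :=
  inferInstanceAs (CompleteSpace (Completion (PreEnveloping A)))

/-- The canonical map into the completion. -/
noncomputable def ofPre (a : PreEnveloping A) : EnvelopingCStarAlgebra A :=
  (a : Completion (PreEnveloping A))

/-- The involution is the continuous extension of the involution of `A`. -/
noncomputable instance : Star (EnvelopingCStarAlgebra A) where
  star := Completion.map (star : PreEnveloping A → PreEnveloping A)

theorem ofPre_add (a b : PreEnveloping A) : ofPre (a + b) = ofPre a + ofPre b :=
  Completion.coe_add a b
theorem ofPre_mul (a b : PreEnveloping A) : ofPre (a * b) = ofPre a * ofPre b :=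
  Completion.coe_mul a b
theorem ofPre_smul (z : ℂ) (a : PreEnveloping A) : ofPre (z • a) = z • ofPre a :=
  Completion.coe_smul z a
theorem norm_ofPre (a : PreEnveloping A) : ‖ofPre a‖ = ‖a‖ := Completion.norm_coe a

theorem uniformContinuous_star_pre :
    UniformContinuous (star : PreEnveloping A → PreEnveloping A) :=
  (starₗᵢ ℂ : PreEnveloping A ≃ₗᵢ⋆[ℂ] PreEnveloping A).lipschitz.uniformContinuous

theorem continuous_star : Continuous (star : EnvelopingCStarAlgebra A → EnvelopingCStarAlgebra A) :=
  Completion.continuous_map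

theorem star_ofPre (a : PreEnveloping A) :
    star (ofPre a) =
      ofPre (star a) :=
  Completion.map_coe uniformContinuous_star_pre a

theorem induction_on {p : EnvelopingCStarAlgebra A → Prop} (x : EnvelopingCStarAlgebra A)
    (hp : IsClosed {x | p x})
    (h : ∀ a : PreEnveloping A, p (ofPre a)) : p x :=
  Completion.induction_on x hp h

theorem induction_on₂ {p : EnvelopingCStarAlgebra A → EnvelopingCStarAlgebra A → Prop}
    (x y : EnvelopingCStarAlgebra A)
    (hp : IsClosed {q : EnvelopingCStarAlgebra A × EnvelopingCStarAlgebra A | p q.1 q.2})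
    (h : ∀ a b : PreEnveloping A,
      p (ofPre a) (ofPre b)) : p x y :=
  Completion.induction_on₂ x y hp h

noncomputable instance : StarRing (EnvelopingCStarAlgebra A) where
  star_involutive x := by
    induction x using induction_on with
    | hp => exact isClosed_eq (continuous_star.comp continuous_star) continuous_id
    | h a => rw [star_ofPre, star_ofPre, star_star]
  star_add x y := by
    induction x, y using induction_on₂ with
    | hp =>
      exact isClosed_eq (continuous_star.comp continuous_add)
        ((continuous_star.comp continuous_fst).add (continuous_star.comp continuous_snd))
    | h a b =>
      rw [← ofPre_add, star_ofPre, star_ofPre, star_ofPre, star_add, ofPre_add]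
  star_mul x y := by
    induction x, y using induction_on₂ with
    | hp =>
      exact isClosed_eq (continuous_star.comp continuous_mul)
        ((continuous_star.comp continuous_snd).mul (continuous_star.comp continuous_fst))
    | h a b =>
      rw [← ofPre_mul, star_ofPre, star_ofPre, star_ofPre, star_mul, ofPre_mul]

noncomputable instance : CStarAlgebra (EnvelopingCStarAlgebra A) where
  norm_mul_self_le x := by
    induction x using induction_on with
    | hp =>
      exact isClosed_le (continuous_norm.mul continuous_norm)
        (continuous_norm.comp (continuous_star.mul continuous_id))
    | h a =>
      rw [star_ofPre, ← ofPre_mul, norm_ofPre, norm_ofPre, PreEnveloping.norm_star_mul_self']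
  norm_smul_le z x := norm_smul_le (α := ℂ) (β := Completion (PreEnveloping A)) z x
  star_smul z x := by
    induction x using induction_on with
    | hp =>
      exact isClosed_eq (continuous_star.comp (continuous_const_smul z))
        (by exact continuous_star.const_smul (star z))
    | h a =>
      rw [← ofPre_smul, star_ofPre, star_ofPre, star_smul, ofPre_smul]

/-- The canonical `*`-homomorphism of `A` into its enveloping `C*`-algebra. -/
noncomputable def of : A →⋆ₐ[ℂ] EnvelopingCStarAlgebra A where
  toFun a := ofPre a
  map_one' := rfl
  map_mul' a b := ofPre_mul a b
  map_zero' := rfl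
  map_add' a b := ofPre_add a b
  commutes' _ := rfl
  map_star' a := (star_ofPre a).symm

end EnvelopingCStarAlgebra

end Enveloping

/-! ### The full twisted group `C*`-algebra and primeness -/

/-- The full twisted group `C*`-algebra `C*(G, σ)`: the universal enveloping `C*`-algebra of
`ℓ¹(G, σ)`. -/
abbrev FullTwistedGroupCStarAlgebra {G : Type*} [Group G] (σ : Multiplier G) : Type _ :=
  EnvelopingCStarAlgebra (TwistedL1 σ)

/-- A `C*`-algebra is prime if nonzero ideals have nonzero intersection. As usual for
`C*`-algebras, an ideal is a closed two-sided ideal. -/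
def IsPrimeCStarAlgebra (A : Type*) [CStarAlgebra A] : Prop :=
  ∀ I J : TwoSidedIdeal A, IsClosed (I : Set A) → IsClosed (J : Set A) →
    I ≠ ⊥ → J ≠ ⊥ → I ⊓ J ≠ ⊥

/-! The argument is by contraposition: a finite `σ`-regular class other than `{e}` produces a
non-scalar central element of `C*(G, σ)`, while a prime `C*`-algebra has only scalars in its centre.

For the centre: a non-scalar self-adjoint central `s` has two distinct spectral points. Functional
calculus then gives two nonzero central elements with product zero, and these generate ideals that
primeness forbids (`IsPrimeCStarAlgebra.mul_ne_zero`). Real and imaginary parts reduce the general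
case to this one.

For the central element: in the twisted group algebra, conjugation by `δ_c` sends `δ_a` to a circle
multiple of `δ_{c a c⁻¹}`. Regularity of `a` says exactly that this multiple depends only on `c a
c⁻¹` (`IsRegular.conjFactor_congr`). Hence the multiples define a function on the class that is
invariant under every such conjugation. Finiteness of the class puts it in `ℓ¹(G, σ)`, where it is
central, and by density its image is central in `C*(G, σ)`.

This image is not a scalar, because `ℓ¹(G, σ)` embeds in `C*(G, σ)` (`TwistedL1.of_injective`): the
twisted regular representation on `ℓ²(G)` is already faithful on `ℓ¹(G, σ)`. -/

/-! ### Central elements of prime `C*`-algebras -/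

section Prime

variable {A : Type*} [CStarAlgebra A]

/-- The left annihilator of a set stable under left multiplication, as a two-sided ideal. -/
def TwoSidedIdeal.leftAnnihilator {R : Type*} [Ring R] (S : Set R)
    (hS : ∀ x, ∀ y ∈ S, x * y ∈ S) : TwoSidedIdeal R :=
  .mk' {x | ∀ y ∈ S, x * y = 0} (fun y _ => zero_mul y)
    (fun hx hx' y hy => by rw [add_mul, hx y hy, hx' y hy, add_zero])
    (fun hx y hy => by rw [neg_mul, hx y hy, neg_zero])
    (fun hx y hy => by rw [mul_assoc, hx y hy, mul_zero])
    (fun hx y hy => by rw [mul_assoc]; exact hx _ (hS _ y hy))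

theorem TwoSidedIdeal.mem_leftAnnihilator {R : Type*} [Ring R] {S : Set R}
    {hS : ∀ x, ∀ y ∈ S, x * y ∈ S} {x : R} :
    x ∈ leftAnnihilator S hS ↔ ∀ y ∈ S, x * y = 0 :=
  TwoSidedIdeal.mem_mk' ..

theorem TwoSidedIdeal.isClosed_leftAnnihilator {R : Type*} [Ring R] [TopologicalSpace R]
    [T2Space R] [ContinuousMul R] (S : Set R) (hS : ∀ x, ∀ y ∈ S, x * y ∈ S) :
    IsClosed (leftAnnihilator S hS : Set R) := by
  rw [leftAnnihilator, coe_mk']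
  simp only [Set.ofPred_forall]
  exact isClosed_iInter fun y => isClosed_iInter fun _ =>
    isClosed_eq (continuous_mul_const y) continuous_const

/-- A nonzero self-adjoint central element of a prime `C*`-algebra is not a zero divisor. -/
theorem IsPrimeCStarAlgebra.mul_ne_zero (h : IsPrimeCStarAlgebra A) {u v : A}
    (hu : ∀ x, Commute u x) (hsa : IsSelfAdjoint u)
    (hu0 : u ≠ 0) (hv0 : v ≠ 0) : u * v ≠ 0 := by
  intro huv
  let I : TwoSidedIdeal A := .leftAnnihilator {y | ∃ x, y = x * u} (by
    rintro x _ ⟨y, rfl⟩; exact ⟨x * y, (mul_assoc ..).symm⟩)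
  -- With `u * v = 0`, the annihilator `I` of `u` contains `v` and its own annihilator `J` contains
  -- `u`, so both are nonzero.
  let J : TwoSidedIdeal A := .leftAnnihilator (I : Set A) fun x y hy => I.mul_mem_left x y hy
  have hI {x : A} : x ∈ I ↔ x * u = 0 := by
    refine TwoSidedIdeal.mem_leftAnnihilator.trans ⟨fun hx => hx u ⟨1, (one_mul u).symm⟩, ?_⟩
    rintro hx _ ⟨y, rfl⟩
    rw [← (hu y).eq, ← mul_assoc, hx, zero_mul]
  have hJ {x : A} : x ∈ J ↔ ∀ y ∈ I, x * y = 0 := TwoSidedIdeal.mem_leftAnnihilator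
  have hvI : v ∈ I := hI.2 (by rw [← (hu v).eq, huv])
  have huJ : u ∈ J := hJ.2 fun y hy => by rw [(hu y).eq, hI.1 hy]
  refine h I J (TwoSidedIdeal.isClosed_leftAnnihilator _ _)
    (TwoSidedIdeal.isClosed_leftAnnihilator _ _) ?_ ?_ ?_
  · intro h0; rw [h0, TwoSidedIdeal.mem_bot] at hvI; exact hv0 hvI
  · intro h0; rw [h0, TwoSidedIdeal.mem_bot] at huJ; exact hu0 huJ
  · refine eq_bot_iff.2 fun x hx => ?_
    obtain ⟨hxI, hxJ⟩ := (TwoSidedIdeal.mem_inf _).1 hx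
    -- `I` is self-adjoint because `u` is central and self-adjoint. So `x ∈ J` kills `star x ∈ I`,
    -- and the `C*`-identity gives `x = 0`.
    have hs : star x ∈ I := hI.2 <| by
      rw [← (hu _).eq]
      nth_rw 1 [← hsa.star_eq]
      rw [← star_mul, hI.1 hxI, star_zero]
    exact TwoSidedIdeal.mem_bot _ |>.2 (CStarRing.mul_star_self_eq_zero_iff x |>.1 (hJ.1 hxJ _ hs))

/-- Self-adjoint central elements of a prime `C*`-algebra are scalars. -/
theorem IsPrimeCStarAlgebra.exists_real_of_central (h : IsPrimeCStarAlgebra A) {s : A}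
    (hs : IsSelfAdjoint s) (hc : ∀ x, Commute s x) : ∃ r : ℝ, s = algebraMap ℝ A r := by
  by_contra! hne
  have hA : Nontrivial A := ⟨s, _, hne 0⟩
  obtain ⟨p, hp⟩ : (spectrum ℝ s).Nonempty := ContinuousFunctionalCalculus.spectrum_nonempty s hs
  obtain ⟨q, hq, hqp⟩ : ∃ q ∈ spectrum ℝ s, q ≠ p := by
    by_contra! hall
    exact hne p (CFC.eq_algebraMap_of_spectrum_subset_singleton s p fun q hq => hall q hq)
  -- The midpoint separates the two spectral points: `g` below is positive only on the side of `p`,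
  -- `k` only on the side of `q`, so `g * k = 0`.
  let m := (p + q) / 2
  have key (f : ℝ → ℝ) (hf : Continuous f) (t : ℝ) (ht : t ∈ spectrum ℝ s) (h0 : f t ≠ 0) :
      cfc f s ≠ 0 := by
    intro hz
    have hmem : f t ∈ spectrum ℝ (cfc f s) := by
      rw [cfc_map_spectrum f s hs hf.continuousOn]
      exact ⟨t, ht, rfl⟩
    rw [hz, spectrum.zero_eq] at hmem
    exact h0 hmem
  have hcomm (f : ℝ → ℝ) (x : A) : Commute (cfc f s) x := (hc x).cfc_real f
  let g : ℝ → ℝ := fun t => max 0 ((p - m) * (t - m))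
  let k : ℝ → ℝ := fun t => max 0 ((q - m) * (t - m))
  have hg : Continuous g := by fun_prop
  have hk : Continuous k := by fun_prop
  have hpm : 0 < (p - m) ^ 2 := by
    have : p - m ≠ 0 := fun h0 => hqp (by simp only [m] at h0; linarith)
    positivity
  have hmq : q - m = -(p - m) := by simp only [m]; ring
  refine h.mul_ne_zero (hcomm g) (cfc_predicate g s)
    (key g hg p hp ?_) (key k hk q hq ?_) ?_
  · simp only [g]; rw [max_eq_right] <;> nlinarith
  · simp only [k, hmq]; rw [max_eq_right] <;> nlinarith
  · rw [← cfc_mul g k s hg.continuousOn hk.continuousOn]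
    have : (fun t => g t * k t) = fun _ => 0 := by
      funext t
      simp only [g, k, hmq]
      rcases le_total 0 ((p - m) * (t - m)) with h1 | h1
      · rw [max_eq_left (b := -(p - m) * (t - m)) (by linarith), mul_zero]
      · rw [max_eq_left h1, zero_mul]
    rw [this, cfc_const_zero]

/-- Central elements of a prime `C*`-algebra are scalars. -/
theorem IsPrimeCStarAlgebra.exists_eq_algebraMap_of_central (h : IsPrimeCStarAlgebra A) {z : A}
    (hz : ∀ x, Commute z x) : ∃ c : ℂ, z = algebraMap ℂ A c := by
  have hz' (x : A) : Commute (star z) x := by simpa using (hz (star x)).star_star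
  obtain ⟨r, hr⟩ := h.exists_real_of_central (realPart z).2 fun x => by
    rw [realPart_apply_coe]
    exact ((hz x).add_left (hz' x)).smul_left _
  obtain ⟨i, hi⟩ := h.exists_real_of_central (imaginaryPart z).2 fun x => by
    rw [imaginaryPart_apply_coe]
    exact (((hz x).sub_left (hz' x)).smul_left _).smul_left _
  refine ⟨r + Complex.I * i, ?_⟩
  rw [← realPart_add_I_smul_imaginaryPart z, hr, hi, map_add, map_mul,
    IsScalarTower.algebraMap_apply ℝ ℂ A, IsScalarTower.algebraMap_apply ℝ ℂ A, Algebra.smul_def]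
  rfl

end Prime

/-! ### The twisted left regular representation -/

namespace TwistedL1

variable {G : Type*} [Group G] {σ : Multiplier G}

variable (σ) in
/-- The twisted left translation `(L_b ξ)(a) = σ(b, b⁻¹ a) ξ(b⁻¹ a)` on `ℓ²(G)`. -/
noncomputable def translation (b : G) :
    lp (fun _ : G => ℂ) 2 →ₗᵢ[ℂ] lp (fun _ : G => ℂ) 2 :=
  LinearMap.isometryOfInner
    { toFun := fun ξ => ⟨fun a => σ b (b⁻¹ * a) * ξ (b⁻¹ * a), memℓp_gen (p := 2) <| by
        have h := (lp.memℓp ξ).summable (by simp)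
        rw [← (Equiv.mulLeft b⁻¹).summable_iff] at h
        simpa only [Function.comp_def, Equiv.coe_mulLeft, norm_mul, Circle.norm_coe, one_mul]
          using h⟩
      map_add' := fun ξ η => by ext a; exact mul_add _ _ _
      map_smul' := fun z ξ => by ext a; exact mul_left_comm _ _ _ }
    fun ξ η => by
      rw [lp.inner_eq_tsum, lp.inner_eq_tsum, ← (Equiv.mulLeft b⁻¹).tsum_eq fun a => inner ℂ (ξ a) (η a)]
      refine tsum_congr fun a => ?_
      simp only [LinearMap.coe_mk, AddHom.coe_mk, Equiv.coe_mulLeft, RCLike.inner_apply, map_mul]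
      linear_combination (η (b⁻¹ * a) * conj (ξ (b⁻¹ * a))) *
        circle_conj_mul (σ b (b⁻¹ * a))

theorem translation_apply (b : G) (ξ : lp (fun _ : G => ℂ) 2) (a : G) :
    translation σ b ξ a = σ b (b⁻¹ * a) * ξ (b⁻¹ * a) := rfl

variable (σ) in
/-- The twisted left translation as a bounded operator. -/
noncomputable def translationCLM (b : G) :
    lp (fun _ : G => ℂ) 2 →L[ℂ] lp (fun _ : G => ℂ) 2 :=
  (translation σ b).toContinuousLinearMap

theorem translationCLM_apply (b : G) (ξ : lp (fun _ : G => ℂ) 2) (a : G) :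
    translationCLM σ b ξ a = σ b (b⁻¹ * a) * ξ (b⁻¹ * a) := rfl

theorem translationCLM_one : translationCLM σ 1 = 1 := by
  ext ξ a
  simp [translationCLM_apply]

theorem translationCLM_mul (b c : G) :
    translationCLM σ b * translationCLM σ c = (σ b c : ℂ) • translationCLM σ (b * c) := by
  ext ξ a
  have h := cocycle_coe (σ := σ) b c (c⁻¹ * (b⁻¹ * a))
  rw [mul_inv_cancel_left] at h
  change translationCLM σ b (translationCLM σ c ξ) a = σ b c * translationCLM σ (b * c) ξ a
  simp only [translationCLM_apply, mul_inv_rev, mul_assoc]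
  linear_combination -ξ (c⁻¹ * (b⁻¹ * a)) * h

/-- Translations are unitary and `L_a L_{a⁻¹} = σ(a, a⁻¹)`, which forces this scalar. The proof
checks the adjoint relation directly, using the cocycle identity at `(a, a⁻¹, a x)`. -/
theorem star_translationCLM_inv (a : G) :
    star (translationCLM σ a⁻¹) = conj (σ a a⁻¹ : ℂ) • translationCLM σ a := by
  rw [ContinuousLinearMap.star_eq_adjoint, eq_comm, ContinuousLinearMap.eq_adjoint_iff]
  intro η ξ
  rw [lp.inner_eq_tsum, lp.inner_eq_tsum, ← (Equiv.mulLeft a).tsum_eq]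
  refine tsum_congr fun x => ?_
  have h := cocycle_coe (σ := σ) a a⁻¹ (a * x)
  rw [mul_inv_cancel, Multiplier.map_one_left, inv_mul_cancel_left, Circle.coe_one, mul_one] at h
  change inner ℂ (conj (σ a a⁻¹ : ℂ) * translationCLM σ a η (a * x)) (ξ (a * x)) =
    inner ℂ (η x) (translationCLM σ a⁻¹ ξ x)
  simp only [translationCLM_apply, RCLike.inner_apply, map_mul, inv_mul_cancel_left, inv_inv,
    Complex.conj_conj, h]
  linear_combination (ξ (a * x) * conj (η x) * σ a⁻¹ (a * x)) * circle_conj_mul (σ a x)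

theorem norm_translationCLM_le (b : G) : ‖translationCLM σ b‖ ≤ 1 :=
  (translation σ b).norm_toContinuousLinearMap_le

theorem summable_norm_smul_translationCLM (f : TwistedL1 σ) :
    Summable fun b => ‖f b • translationCLM σ b‖ :=
  .of_nonneg_of_le (fun _ => norm_nonneg _) (fun b => by
    rw [norm_smul]
    exact mul_le_of_le_one_right (norm_nonneg _) (norm_translationCLM_le b)) f.summable_norm

theorem summable_smul_translationCLM (f : TwistedL1 σ) :
    Summable fun b => f b • translationCLM σ b :=
  (summable_norm_smul_translationCLM f).of_norm

/-- The integrated form of the twisted left regular representation is multiplicative. -/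
theorem tsum_mul_smul_translationCLM (f g : TwistedL1 σ) :
    ∑' a, (f * g) a • translationCLM σ a =
      (∑' b, f b • translationCLM σ b) * ∑' c, g c • translationCLM σ c := by
  have hs := (summable_mul_of_summable_norm (summable_norm_smul_translationCLM f)
    (summable_norm_smul_translationCLM g))
  rw [tsum_mul_tsum_of_summable_norm (summable_norm_smul_translationCLM f)
    (summable_norm_smul_translationCLM g), ← (convEquiv G).tsum_eq]
  rw [← (convEquiv G).summable_iff] at hs
  refine Eq.trans ?_ (hs.tsum_prod).symm
  refine tsum_congr fun a => ?_
  rw [mul_apply, ← (summable_term f g a).tsum_smul_const]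
  refine tsum_congr fun b => ?_
  simp only [Function.comp_apply, convEquiv_apply]
  rw [smul_mul_smul_comm, translationCLM_mul, mul_inv_cancel_left, smul_smul]
  congr 1
  ring

/-- After `a ↦ a⁻¹` the two series agree term by term: the factor `conj σ(a, a⁻¹)` in the involution
is the one in `star_translationCLM_inv`. -/
theorem tsum_star_smul_translationCLM (f : TwistedL1 σ) :
    ∑' a, (star f) a • translationCLM σ a = star (∑' b, f b • translationCLM σ b) := by
  rw [tsum_star, ← (Equiv.inv G).tsum_eq]
  refine tsum_congr fun a => ?_
  rw [Equiv.inv_apply, star_smul]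
  have h := star_translationCLM_inv (σ := σ) a⁻¹
  rw [inv_inv] at h
  rw [h, smul_smul, star_apply, inv_inv, mul_comm]
  rfl

variable (σ) in
/-- The twisted left regular representation of `ℓ¹(G, σ)` on `ℓ²(G)`. -/
noncomputable def regularRep :
    TwistedL1 σ →⋆ₐ[ℂ] (lp (fun _ : G => ℂ) 2 →L[ℂ] lp (fun _ : G => ℂ) 2) :=
  { AlgHom.ofLinearMap
      { toFun := fun f : TwistedL1 σ => ∑' b, f b • translationCLM σ b
        map_add' := fun f g => by
          simp only [add_apply, add_smul]
          exact (summable_smul_translationCLM f).tsum_add (summable_smul_translationCLM g)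
        map_smul' := fun z f => by
          simp only [smul_apply, mul_smul, RingHom.id_apply]
          exact (summable_smul_translationCLM f).tsum_const_smul z }
      (by
        change ∑' b, (1 : TwistedL1 σ) b • translationCLM σ b = 1
        rw [tsum_eq_single 1 fun b hb => by rw [one_apply_ne hb, zero_smul], one_apply_one,
          one_smul, translationCLM_one])
      tsum_mul_smul_translationCLM with
    map_star' := tsum_star_smul_translationCLM }

theorem regularRep_apply (f : TwistedL1 σ) :
    regularRep σ f = ∑' b, f b • translationCLM σ b := rfl

open Classical in
/-- The matrix coefficients of the twisted left regular representation at the point mass at the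
identity. -/
theorem regularRep_single_one_apply (f : TwistedL1 σ) (a : G) :
    regularRep σ f (lp.single 2 1 1) a = f a := by
  -- Evaluation at `δ_1` and pairing with `δ_a` are continuous, so they pass through the operator
  -- series. Since `L_b δ_1` is supported at `b`, only `b = a` survives.
  have h := (innerSL ℂ (lp.single (E := fun _ : G => ℂ) 2 a 1)).hasSum
    ((ContinuousLinearMap.apply ℂ (lp (fun _ : G => ℂ) 2)
      (lp.single (E := fun _ : G => ℂ) 2 1 1)).hasSum (summable_smul_translationCLM f).hasSum)
  have h2 := h.tsum_eq
  simp only [ContinuousLinearMap.apply_apply, innerSL_apply_apply, lp.inner_single_left,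
    ← regularRep_apply] at h2
  rw [tsum_eq_single a] at h2
  · simpa [translationCLM_apply] using h2.symm
  · intro b hb
    have : b⁻¹ * a ≠ 1 := fun h0 => hb (inv_mul_eq_one.1 h0)
    simp [translationCLM_apply, this]

theorem regularRep_injective : Function.Injective (regularRep σ) := fun f g h => by
  classical
  ext a
  rw [← regularRep_single_one_apply, h, regularRep_single_one_apply]

/-- The canonical map of `ℓ¹(G, σ)` into the full twisted group `C*`-algebra is injective. -/
theorem of_injective :
    Function.Injective (EnvelopingCStarAlgebra.of : TwistedL1 σ →⋆ₐ[ℂ] _) := by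
  refine (injective_iff_map_eq_zero _).2 fun f hf => ?_
  refine (injective_iff_map_eq_zero _).1 regularRep_injective f (norm_le_zero_iff.1 ?_)
  -- The enveloping seminorm dominates the norm in the regular representation, so vanishing in the
  -- completion forces `regularRep σ f = 0`.
  refine (PreEnveloping.le_norm (A := TwistedL1 σ) (regularRep σ) f).trans_eq ?_
  exact (EnvelopingCStarAlgebra.norm_ofPre (A := TwistedL1 σ) f).symm.trans (norm_eq_zero.2 hf)

end TwistedL1

/-! ### Central elements attached to finite regular conjugacy classes -/

namespace Multiplier

variable {G : Type*} [Group G] (σ : Multiplier G)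

/-- The scalar `z` with `δ_c δ_x = z δ_{c x c⁻¹} δ_c` in the twisted group algebra. -/
noncomputable def conjFactor (c x : G) : Circle := σ c x * (σ (c * x * c⁻¹) c)⁻¹

theorem conjFactor_mul_apply (c x : G) : σ.conjFactor c x * σ (c * x * c⁻¹) c = σ c x :=
  inv_mul_cancel_right _ _

/-- Conjugating by `δ_y δ_c`, a scalar multiple of `δ_{yc}`, is conjugating by `δ_c` and then by
`δ_y`; the scalar `σ(y, c)` cancels. In terms of `σ` this combines three instances of the cocycle
identity. -/
theorem conjFactor_mul (y c x : G) :
    σ.conjFactor (y * c) x = σ.conjFactor c x * σ.conjFactor y (c * x * c⁻¹) := by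
  set z := c * x * c⁻¹ with hz
  set w := y * z * y⁻¹ with hw
  have hcx : c * x = z * c := by simp [hz]
  have hyz : y * z = w * y := by simp [hw]
  have e : y * c * x * (y * c)⁻¹ = w := by simp [hw, hz, mul_assoc]
  have a1 := σ.conjFactor_mul_apply (y * c) x
  have a2 := σ.conjFactor_mul_apply c x
  have a3 := σ.conjFactor_mul_apply y z
  rw [e] at a1
  rw [← hz] at a2
  rw [← hw] at a3
  have c1 := σ.cocycle y c x
  have c2 := σ.cocycle y z c
  have c3 := σ.cocycle w y c
  rw [hcx, ← a1, ← a2] at c1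
  rw [hyz, ← a3] at c2
  refine mul_right_cancel (b := σ w (y * c) * σ y c * σ w y * σ (w * y) c) ?_
  calc _ = (σ y c * (σ.conjFactor (y * c) x * σ w (y * c))) * (σ w y * σ (w * y) c) := by ac_rfl
    _ = σ.conjFactor c x * (σ y (z * c) * σ z c) * (σ w y * σ (w * y) c) := by
      rw [c1]; ac_rfl
    _ = σ.conjFactor c x * σ.conjFactor y z * (σ w y * σ (w * y) c) * (σ w y * σ (w * y) c) := by
      rw [← c2]; ac_rfl
    _ = _ := by nth_rw 1 [c3]; ac_rfl

variable {σ} in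
-- Two such conjugators differ by some `k` centralizing `a`, whose factor `σ(k, a) σ(a, k)⁻¹` is `1`
-- by regularity.
theorem IsRegular.conjFactor_congr {a : G} (ha : σ.IsRegular a) {c d : G}
    (h : c * a * c⁻¹ = d * a * d⁻¹) : σ.conjFactor c a = σ.conjFactor d a := by
  obtain ⟨k, rfl⟩ : ∃ k, d = c * k := ⟨c⁻¹ * d, by simp⟩
  have hk : k * a * k⁻¹ = a := by
    have h' : c * (k * a * k⁻¹) * c⁻¹ = c * a * c⁻¹ := by
      rw [h]; simp [mul_assoc]
    exact mul_left_cancel (mul_right_cancel h')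
  have hka : Commute k a := mul_inv_eq_iff_eq_mul.1 hk
  have h1 : σ.conjFactor k a = 1 := by
    rw [conjFactor, hk, ha k hka, mul_inv_cancel]
  rw [conjFactor_mul, hk, h1, one_mul]

open Classical in
/-- The function supported on the conjugacy class of `a` with value `conjFactor c a` at
`c a c⁻¹`. -/
noncomputable def classFun (a x : G) : ℂ :=
  if h : ∃ c, c * a * c⁻¹ = x then (σ.conjFactor h.choose a : ℂ) else 0

variable {σ} in
theorem IsRegular.classFun_conj {a : G} (ha : σ.IsRegular a) (c : G) :
    σ.classFun a (c * a * c⁻¹) = σ.conjFactor c a := by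
  have h : ∃ d, d * a * d⁻¹ = c * a * c⁻¹ := ⟨c, rfl⟩
  rw [classFun, dif_pos h, ha.conjFactor_congr h.choose_spec]

theorem classFun_of_not {a x : G} (h : ¬∃ c, c * a * c⁻¹ = x) : σ.classFun a x = 0 := dif_neg h

variable {σ} in
-- This is `f * δ_y = δ_y * f` evaluated at `y x`, for `f` the class function. On the class it is
-- `conjFactor_mul`; off the class both sides vanish.
theorem IsRegular.classFun_conj_mul {a : G} (ha : σ.IsRegular a) (x y : G) :
    σ.classFun a (y * x * y⁻¹) * σ (y * x * y⁻¹) y = σ y x * σ.classFun a x := by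
  by_cases h : ∃ c, c * a * c⁻¹ = x
  · obtain ⟨c, rfl⟩ := h
    have e : y * (c * a * c⁻¹) * y⁻¹ = y * c * a * (y * c)⁻¹ := by simp [mul_assoc]
    rw [← σ.conjFactor_mul_apply y (c * a * c⁻¹), ha.classFun_conj, e, ha.classFun_conj,
      conjFactor_mul]
    push_cast
    ring
  · have h' : ¬∃ c, c * a * c⁻¹ = y * x * y⁻¹ := by
      rintro ⟨c, hc⟩
      exact h ⟨y⁻¹ * c, by
        rw [show y⁻¹ * c * a * (y⁻¹ * c)⁻¹ = y⁻¹ * (c * a * c⁻¹) * y by simp [mul_assoc], hc]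
        simp [mul_assoc]⟩
    rw [classFun_of_not σ h, classFun_of_not σ h', zero_mul, mul_zero]

end Multiplier

/-! ### Centrality in `ℓ¹(G, σ)` and in `C*(G, σ)`, and the main theorem -/

namespace TwistedL1

variable {G : Type*} [Group G] {σ : Multiplier G}

/-- The hypothesis expresses commutation with each `δ_y`. Substituting `b ↦ a b⁻¹` in `(f * g)(a)`
makes the two convolution sums agree term by term. -/
theorem commute_of_forall_conj {f : TwistedL1 σ}
    (hf : ∀ x y, f (y * x * y⁻¹) * σ (y * x * y⁻¹) y = σ y x * f x) (g : TwistedL1 σ) :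
    Commute f g := by
  refine ext fun a => ?_
  rw [mul_apply, mul_apply, ← ((Equiv.inv G).trans (Equiv.mulLeft a)).tsum_eq]
  refine tsum_congr fun b => ?_
  have h := hf (b⁻¹ * a) b
  have e : b * (b⁻¹ * a) * b⁻¹ = a * b⁻¹ := by group
  have e' : (a * b⁻¹)⁻¹ * a = b := by group
  rw [e] at h
  simp only [Equiv.trans_apply, Equiv.inv_apply, Equiv.coe_mulLeft, e']
  rw [h]
  ring

/-- The image of a central element of `ℓ¹(G, σ)` is central in `C*(G, σ)`. -/
theorem commute_of {f : TwistedL1 σ} (hf : ∀ g, Commute f g)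
    (x : FullTwistedGroupCStarAlgebra σ) : Commute (EnvelopingCStarAlgebra.of f) x := by
  induction x using EnvelopingCStarAlgebra.induction_on with
  | hp => exact isClosed_eq (continuous_const_mul _) (continuous_mul_const _)
  | h g => exact (hf g).map (EnvelopingCStarAlgebra.of : TwistedL1 σ →⋆ₐ[ℂ] _)

end TwistedL1

theorem mainTheorem2 {G : Type*} [Group G] (σ : Multiplier G)
    (h : IsPrimeCStarAlgebra (FullTwistedGroupCStarAlgebra σ)) : σ.ConditionK := by
  intro C hC hreg hfin
  obtain ⟨a, rfl⟩ := ConjClasses.exists_rep C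
  have ha : σ.IsRegular a := hreg a ConjClasses.mem_carrier_mk
  have ha1 : a ≠ 1 := fun h1 => hC (by rw [h1]; rfl)
  have hsupp : (Function.support fun x => ‖σ.classFun a x‖).Finite := by
    refine hfin.subset fun x hx => ?_
    by_contra hx'
    refine hx ?_
    change ‖σ.classFun a x‖ = 0
    rw [σ.classFun_of_not, norm_zero]
    rintro ⟨c, hc⟩
    exact hx' (ConjClasses.mem_carrier_iff_mk_eq.2
      (ConjClasses.mk_eq_mk_iff_isConj.2 (isConj_iff.2 ⟨c, hc⟩)).symm)
  let f : TwistedL1 σ := .mk (σ.classFun a) (summable_of_hasFiniteSupport hsupp)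
  have hf (g : TwistedL1 σ) : Commute f g :=
    TwistedL1.commute_of_forall_conj ha.classFun_conj_mul g
  obtain ⟨c, hc⟩ := h.exists_eq_algebraMap_of_central (TwistedL1.commute_of hf)
  -- Seen as the image of a scalar of `ℓ¹(G, σ)`, the equation pulls back by injectivity to `f = c •
  -- 1`. At `a ≠ 1` the right side is `0`, while `f a` lies on the circle.
  rw [← AlgHomClass.commutes (EnvelopingCStarAlgebra.of : TwistedL1 σ →⋆ₐ[ℂ] _)] at hc
  have hfa : f a = (algebraMap ℂ (TwistedL1 σ) c) a := by rw [TwistedL1.of_injective hc]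
  rw [Algebra.algebraMap_eq_smul_one, TwistedL1.smul_apply, TwistedL1.one_apply_ne ha1,
    mul_zero] at hfa
  have h1 := ha.classFun_conj 1
  rw [one_mul, inv_one, mul_one] at h1
  exact Circle.coe_ne_zero _ (h1.symm.trans hfa)
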